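/- Let $\Phi$ be the standard normal distribution function and $z_p$ its $p$-quantile, and put $$\mathrm{CP}(t,z)=\Phi(z\sec t-\tan t)-\Phi(-z\sec t-\tan t).$$ Let $\theta,b_2\in\mathbb R$ and $0<s_2<s_1$ with $b_2^2+s_2^2\le s_1^2$, and let $\hat\theta_1\sim N(\theta,s_1^2)$ and $\hat\theta_2\sim N(\theta+b_2,s_2^2)$ be random variables. For $0<\alpha<1$ let $\mathrm{CI}_2$ be the interval $\hat\theta_2\pm z_{1-\alpha/2}s_1$, and let $\mathrm{CI}_5$ be the interval $\hat\theta_2\pm\tilde z_{1-\alpha/2}s_1$, where $\tilde z_{1-\alpha/2}$ is the solution of $1-\alpha=\mathrm{CP}(\arccos(s_2/s_1),\tilde z_{1-\alpha/2})$. Then: 1. For every $0<\alpha<1$ the number $\tilde z_{1-\alpha/2}$ exists and is unique. 2. If $0.917<1-\alpha<1$, then $\tilde z_{1-\alpha/2}<z_{1-\alpha/2}$, and $\mathrm{CI}_5$ is strictly shorter than $\mathrm{CI}_2$. 3. If $1-\alpha=0.9$, then the length of $\mathrm{CI}_5$ is at most $1.00014$ times the length of $\mathrm{CI}_2$ (that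 is, $\mathrm{CI}_5$ is at most $0.014\%$ longer). 4. If $1-\alpha=0.9$, then $\mathrm{CI}_5$ can be significantly shorter than $\mathrm{CI}_2$: there is $\delta\in(0,1)$ such that, whenever $0<s_2\le\delta s_1$, the length of $\mathrm{CI}_5$ is less than $61\%$ of the length of $\mathrm{CI}_2$. -/

import Mathlib

open MeasureTheory ProbabilityTheory Set

noncomputable section

/-- The standard normal cumulative distribution function `Φ`. -/
def stdNormalCDF (x : ℝ) : ℝ := cdf (gaussianReal 0 1) x

/-- The `p`-quantile `z_p` of the standard normal distribution (meaningful for `0 < p < 1`). -/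
def stdNormalQuantile (p : ℝ) : ℝ := sInf {x : ℝ | p ≤ stdNormalCDF x}

/-- `CP(t, z) = Φ(z sec t - tan t) - Φ(-z sec t - tan t)`: the probability that `θ` lies in
`θhat₂ ± z s₁` when `θhat₂` has bias `s₁ sin t` and standard deviation `s₁ cos t`. -/
def coverageProb (t z : ℝ) : ℝ :=
  stdNormalCDF (z * (Real.cos t)⁻¹ - Real.tan t) -
    stdNormalCDF (-z * (Real.cos t)⁻¹ - Real.tan t)

/-- The interval `center ± c * s`. -/
def symmInterval (center c s : ℝ) : Set ℝ := Icc (center - c * s) (center + c * s)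

/-- The length of a set of reals, as its Lebesgue measure. -/
def intervalLength (I : Set ℝ) : ℝ := volume.real I

/-- `CI₂ = θhat₂ ± z_{1-α/2} s₁`, at the realized value `x` of `θhat₂`. -/
def CI₂ (s₁ α x : ℝ) : Set ℝ := symmInterval x (stdNormalQuantile (1 - α / 2)) s₁

/-- `c` solves the equation `1 - α = CP(arccos (s₂ / s₁), c)`, which defines the critical value
of `CI₅` implicitly. -/
def IsCalibrated (s₁ s₂ α c : ℝ) : Prop :=
  1 - α = coverageProb (Real.arccos (s₂ / s₁)) c

/-- `CI₅ = θhat₂ ± c s₁`, at the realized value `x` of `θhat₂`, where `c` is the calibrated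
critical value (see `IsCalibrated`). -/
def CI₅ (s₁ c x : ℝ) : Set ℝ := symmInterval x c s₁

end

noncomputable section

open Filter Topology

/-! Write `u = z sin t`, `y = sin t ^ 2`. The derivative of `coverageProb t z` in `t` is a positive
factor times `u cosh v - sinh v`, where `v = u / cos t ^ 2`. It is positive when `u ≥ 1` or `v <
artanh u`; for `0 < u < 1` the latter reads `1 / (1 - y) < artanh u / u = 1 + z² y / 3 + z⁴ y² / 5 +
⋯`. The first-order terms give the threshold `z² = 3`, that is, the level `2 Φ(√3) - 1 ≈ 0.9167`.

Above this level coverage increases from its value `2 Φ(z) - 1` at `t = 0`. The ordinary quantile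
therefore overcovers at every positive angle, and since coverage increases in `z`, the calibrated
value is smaller.

At 90% the quantile is below `√3`: coverage first dips, then increases. The critical value
`1.645083`, within 0.014% of the quantile, has coverage at least `0.9000473` at `t = 0`. The dip is
confined to `y ≤ 0.1232`, where integrating a polynomial bound on the derivative shows that at most
`0.0000473` is lost (`le_coverageProb_of_sin_sq_le`); beyond that, coverage increases.

As `s₂ / s₁` tends to `0` the estimator is almost pure bias, at most `s₁`, so any `z > 1` eventually
suffices, against the quantile `1.645`. -/

/-! ### The standard normal distribution function -/

/-- The standard normal density. -/
def stdNormalPDF (x : ℝ) : ℝ := (√(2 * Real.pi))⁻¹ * Real.exp (-x ^ 2 / 2)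

lemma gaussianPDFReal_zero_one (x : ℝ) : gaussianPDFReal 0 1 x = stdNormalPDF x := by
  simp [gaussianPDFReal_def, stdNormalPDF]

lemma stdNormalPDF_pos (x : ℝ) : 0 < stdNormalPDF x := by
  unfold stdNormalPDF; positivity

lemma continuous_stdNormalPDF : Continuous stdNormalPDF := by
  unfold stdNormalPDF; fun_prop

lemma integrable_stdNormalPDF : Integrable stdNormalPDF :=
  (integrable_gaussianPDFReal 0 1).congr (.of_forall gaussianPDFReal_zero_one)

lemma stdNormalCDF_eq_integral (x : ℝ) : stdNormalCDF x = ∫ y in Iic x, stdNormalPDF y := by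
  rw [stdNormalCDF, cdf_eq_real, measureReal_def,
    gaussianReal_apply_eq_integral 0 one_ne_zero, ENNReal.toReal_ofReal]
  · simp_rw [gaussianPDFReal_zero_one]
  · exact integral_nonneg fun y => gaussianPDFReal_nonneg 0 1 y

lemma hasDerivAt_stdNormalCDF (x : ℝ) : HasDerivAt stdNormalCDF (stdNormalPDF x) x := by
  have h : stdNormalCDF = fun x => stdNormalCDF 0 + ∫ y in (0 : ℝ)..x, stdNormalPDF y := by
    funext x
    rw [stdNormalCDF_eq_integral, stdNormalCDF_eq_integral,
      ← intervalIntegral.integral_Iic_sub_Iic integrable_stdNormalPDF.integrableOn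
        integrable_stdNormalPDF.integrableOn]
    ring
  rw [h]
  exact (continuous_stdNormalPDF.integral_hasStrictDerivAt 0 x).hasDerivAt.const_add _

lemma continuous_stdNormalCDF : Continuous stdNormalCDF :=
  continuous_iff_continuousAt.2 fun x => (hasDerivAt_stdNormalCDF x).continuousAt

lemma strictMono_stdNormalCDF : StrictMono stdNormalCDF :=
  strictMono_of_deriv_pos fun x => by
    rw [(hasDerivAt_stdNormalCDF x).deriv]; exact stdNormalPDF_pos x

lemma stdNormalCDF_neg (x : ℝ) : stdNormalCDF (-x) = 1 - stdNormalCDF x := by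
  have h := intervalIntegral.integral_Iic_add_Ioi (b := x) (μ := volume)
    integrable_stdNormalPDF.integrableOn integrable_stdNormalPDF.integrableOn
  have h1 : ∫ y, stdNormalPDF y = 1 := by
    rw [← integral_gaussianPDFReal_eq_one 0 one_ne_zero]
    simp_rw [gaussianPDFReal_zero_one]
  have h2 : ∫ y in Iic (-x), stdNormalPDF y = ∫ y in Ioi x, stdNormalPDF y := by
    have := integral_comp_neg_Iic (-x) stdNormalPDF
    rw [neg_neg] at this
    rw [← this]
    simp [stdNormalPDF]
  rw [stdNormalCDF_eq_integral, stdNormalCDF_eq_integral, h2]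
  linarith

lemma stdNormalCDF_zero : stdNormalCDF 0 = 1 / 2 := by
  have := stdNormalCDF_neg 0
  rw [neg_zero] at this
  linarith

lemma tendsto_stdNormalCDF_atTop : Tendsto stdNormalCDF atTop (𝓝 1) :=
  tendsto_cdf_atTop (gaussianReal 0 1)

lemma tendsto_stdNormalCDF_atBot : Tendsto stdNormalCDF atBot (𝓝 0) :=
  tendsto_cdf_atBot (gaussianReal 0 1)

lemma exists_stdNormalCDF_eq {p : ℝ} (h0 : 0 < p) (h1 : p < 1) : ∃ x, stdNormalCDF x = p := by
  obtain ⟨a, ha⟩ := (tendsto_stdNormalCDF_atBot.eventually (gt_mem_nhds h0)).exists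
  obtain ⟨b, hb⟩ := (tendsto_stdNormalCDF_atTop.eventually (lt_mem_nhds h1)).exists
  exact mem_range_of_exists_le_of_exists_ge continuous_stdNormalCDF ⟨a, ha.le⟩ ⟨b, hb.le⟩

lemma stdNormalCDF_stdNormalQuantile {p : ℝ} (h0 : 0 < p) (h1 : p < 1) :
    stdNormalCDF (stdNormalQuantile p) = p := by
  obtain ⟨x, rfl⟩ := exists_stdNormalCDF_eq h0 h1
  have : {y : ℝ | stdNormalCDF x ≤ stdNormalCDF y} = Ici x := by
    ext y; simp [strictMono_stdNormalCDF.le_iff_le]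
  rw [stdNormalQuantile, this, csInf_Ici]

/-! ### Numerical bounds -/

/-- The Taylor polynomials of `exp (-x)` bound it alternately from below and from above. -/
lemma neg_one_pow_mul_exp_neg_sub_sum_nonneg (n : ℕ) {x : ℝ} (hx : 0 ≤ x) :
    0 ≤ (-1) ^ n * (Real.exp (-x) - ∑ k ∈ Finset.range n, (-x) ^ k / k.factorial) := by
  induction n generalizing x with
  | zero => simpa using (Real.exp_pos (-x)).le
  | succ n ih =>
    -- The signed remainder with `n + 1` terms vanishes at `0` and its derivative is the signed
    -- remainder with `n` terms, nonnegative by induction.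
    have hd : ∀ y : ℝ, HasDerivAt
        (fun x : ℝ => (-1) ^ (n + 1) *
          (Real.exp (-x) - ∑ k ∈ Finset.range (n + 1), (-x) ^ k / k.factorial))
        ((-1) ^ n * (Real.exp (-y) - ∑ k ∈ Finset.range n, (-y) ^ k / k.factorial)) y := by
      intro y
      have h1 : HasDerivAt (fun x : ℝ => Real.exp (-x)) (-Real.exp (-y)) y := by
        simpa using (hasDerivAt_neg y).exp
      have h2 : HasDerivAt (fun x : ℝ => ∑ k ∈ Finset.range (n + 1), (-x) ^ k / k.factorial)
          (-∑ k ∈ Finset.range n, (-y) ^ k / k.factorial) y := by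
        simp_rw [Finset.sum_range_succ']
        have h3 : HasDerivAt (fun x : ℝ => ∑ k ∈ Finset.range n,
            (-x) ^ (k + 1) / (k + 1).factorial)
            (∑ k ∈ Finset.range n, -((-y) ^ k / k.factorial)) y := by
          refine HasDerivAt.fun_sum fun k _ => ?_
          have := ((hasDerivAt_neg y).pow (k + 1)).div_const ((k + 1).factorial : ℝ)
          refine this.congr_deriv ?_
          have : (k.factorial : ℝ) ≠ 0 := by positivity
          have : (k : ℝ) + 1 ≠ 0 := by positivity
          push_cast [Nat.factorial_succ]
          simp
          field_simp
        rw [Finset.sum_neg_distrib] at h3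
        simpa using h3.add_const 1
      refine ((h1.sub h2).const_mul _).congr_deriv ?_
      ring
    have hm := monotoneOn_of_hasDerivWithinAt_nonneg (convex_Ici (0 : ℝ))
      (fun y _ => (hd y).continuousAt.continuousWithinAt)
      (fun y _ => (hd y).hasDerivWithinAt)
      (fun y hy => ih (interior_subset hy))
    have := hm self_mem_Ici hx hx
    refine le_trans (le_of_eq ?_) this
    simp [Finset.sum_range_succ']

/-- The Taylor polynomials of `∫ y in 0..x, exp (-y ^ 2 / 2)` bound it alternately from below
and from above. -/
lemma neg_one_pow_mul_stdNormalCDF_sub_sum_nonneg (n : ℕ) {x : ℝ} (hx : 0 ≤ x) :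
    0 ≤ (-1) ^ n * (√(2 * Real.pi) * (stdNormalCDF x - 1 / 2) -
      ∑ k ∈ Finset.range n, (-1) ^ k * x ^ (2 * k + 1) / (2 ^ k * k.factorial * (2 * k + 1))) := by
  have hd : ∀ y : ℝ, HasDerivAt
      (fun x : ℝ => (-1) ^ n * (√(2 * Real.pi) * (stdNormalCDF x - 1 / 2) -
        ∑ k ∈ Finset.range n,
          (-1) ^ k * x ^ (2 * k + 1) / (2 ^ k * k.factorial * (2 * k + 1))))
      ((-1) ^ n * (Real.exp (-(y ^ 2 / 2)) -
        ∑ k ∈ Finset.range n, (-(y ^ 2 / 2)) ^ k / k.factorial)) y := by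
    intro y
    refine HasDerivAt.const_mul _ (HasDerivAt.sub ?_ (HasDerivAt.fun_sum fun k _ => ?_))
    · refine (((hasDerivAt_stdNormalCDF y).sub_const _).const_mul _).congr_deriv ?_
      rw [stdNormalPDF, mul_inv_cancel_left₀ (by positivity), neg_div]
    · have := (((hasDerivAt_id y).pow (2 * k + 1)).const_mul ((-1 : ℝ) ^ k)).div_const
        (2 ^ k * k.factorial * (2 * k + 1) : ℝ)
      refine this.congr_deriv ?_
      have : (k.factorial : ℝ) ≠ 0 := by positivity
      have : 2 * (k : ℝ) + 1 ≠ 0 := by positivity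
      rw [← neg_div, div_pow, neg_pow (y ^ 2), ← pow_mul]
      simp
      field_simp
  have hm := monotoneOn_of_hasDerivWithinAt_nonneg (convex_Ici (0 : ℝ))
    (fun y _ => (hd y).continuousAt.continuousWithinAt)
    (fun y _ => (hd y).hasDerivWithinAt)
    (fun y _ => neg_one_pow_mul_exp_neg_sub_sum_nonneg n (by positivity))
  have := hm self_mem_Ici hx hx
  refine le_trans (le_of_eq ?_) this
  simp [stdNormalCDF_zero]

lemma sqrt_two_pi_bounds : 2.5066282746 < √(2 * Real.pi) ∧ √(2 * Real.pi) < 2.5066282747 := by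
  have h1 := Real.pi_gt_d20
  have h2 := Real.pi_lt_d20
  constructor
  · apply Real.lt_sqrt_of_sq_lt; norm_num; linarith
  · rw [Real.sqrt_lt' (by norm_num)]; norm_num; linarith

lemma stdNormalCDF_le_of_le_sum {x p : ℝ} (n : ℕ) (hx : 0 ≤ x) (hp : 1 / 2 ≤ p)
    (h : ∑ k ∈ Finset.range (2 * n + 1),
      (-1) ^ k * x ^ (2 * k + 1) / (2 ^ k * k.factorial * (2 * k + 1)) ≤
        2.5066282746 * (p - 1 / 2)) : stdNormalCDF x ≤ p := by
  have h1 := neg_one_pow_mul_stdNormalCDF_sub_sum_nonneg (2 * n + 1) hx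
  rw [Odd.neg_one_pow ⟨n, rfl⟩] at h1
  have h2 := sqrt_two_pi_bounds.1
  nlinarith

lemma le_stdNormalCDF_of_sum_le {x p : ℝ} (n : ℕ) (hx : 0 ≤ x) (hp : 1 / 2 ≤ p)
    (h : 2.5066282747 * (p - 1 / 2) ≤ ∑ k ∈ Finset.range (2 * n),
      (-1) ^ k * x ^ (2 * k + 1) / (2 ^ k * k.factorial * (2 * k + 1))) : p ≤ stdNormalCDF x := by
  have h1 := neg_one_pow_mul_stdNormalCDF_sub_sum_nonneg (2 * n) hx
  rw [Even.neg_one_pow ⟨n, by ring⟩] at h1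
  have h2 := sqrt_two_pi_bounds.2
  have h3 : (0 : ℝ) < √(2 * Real.pi) := by positivity
  nlinarith

/-- `1.7321` is just above `√3`, and `0.9585 = (1 + 0.917) / 2`. -/
lemma stdNormalCDF_le_level_917 : stdNormalCDF 1.7321 ≤ 0.9585 := by
  apply stdNormalCDF_le_of_le_sum 5 (by norm_num) (by norm_num)
  norm_num [Finset.sum_range_succ, Nat.factorial]

lemma stdNormalCDF_le_level_90 : stdNormalCDF 1.6448528 ≤ 0.95 := by
  apply stdNormalCDF_le_of_le_sum 7 (by norm_num) (by norm_num)
  norm_num [Finset.sum_range_succ, Nat.factorial]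

/-- `2 * 0.95002365 - 1 = 0.9000473`: this is the spare coverage at angle `0` that pays for the dip.
The point `1.645083` is `1.00014 * 1.6448528` rounded down. -/
lemma le_stdNormalCDF_level_90 : 0.95002365 ≤ stdNormalCDF 1.645083 := by
  apply le_stdNormalCDF_of_sum_le 7 (by norm_num) (by norm_num)
  norm_num [Finset.sum_range_succ, Nat.factorial]

lemma stdNormalPDF_le_level_90 : stdNormalPDF 1.645083 ≤ 0.1031 := by
  have h1 := neg_one_pow_mul_exp_neg_sub_sum_nonneg 11 (x := 1.645083 ^ 2 / 2) (by norm_num)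
  have h2 := sqrt_two_pi_bounds.1
  rw [stdNormalPDF, inv_mul_le_iff₀ (by positivity), neg_div]
  have h3 : Real.exp (-(1.645083 ^ 2 / 2)) ≤ 2.5066282746 * 0.1031 := by
    norm_num [Finset.sum_range_succ, Nat.factorial] at h1 ⊢
    linarith
  nlinarith

/-! ### The coverage probability as a function of the critical value -/

lemma strictMono_coverageProb {t : ℝ} (ht : 0 < Real.cos t) : StrictMono (coverageProb t) := by
  intro a b hab
  have h := inv_pos.2 ht
  have h1 := strictMono_stdNormalCDF
    (show a * (Real.cos t)⁻¹ - Real.tan t < b * (Real.cos t)⁻¹ - Real.tan t by gcongr)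
  have h2 := strictMono_stdNormalCDF
    (show -b * (Real.cos t)⁻¹ - Real.tan t < -a * (Real.cos t)⁻¹ - Real.tan t by gcongr)
  unfold coverageProb
  linarith

lemma existsUnique_coverageProb_eq {t p : ℝ} (ht : 0 < Real.cos t) (h0 : 0 < p) (h1 : p < 1) :
    ∃! c, p = coverageProb t c := by
  have hcont : Continuous (coverageProb t) := by
    unfold coverageProb
    have := continuous_stdNormalCDF
    fun_prop
  have hlim : Tendsto (coverageProb t) atTop (𝓝 1) := by
    have hc := inv_pos.2 ht
    have ha : Tendsto (fun z : ℝ => z * (Real.cos t)⁻¹ - Real.tan t) atTop atTop :=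
      tendsto_atTop_add_const_right _ _ (tendsto_id.atTop_mul_const hc)
    have hb : Tendsto (fun z : ℝ => -z * (Real.cos t)⁻¹ - Real.tan t) atTop atBot :=
      tendsto_atBot_add_const_right _ _ (tendsto_neg_atTop_atBot.atBot_mul_const hc)
    rw [← sub_zero (1 : ℝ)]
    exact (tendsto_stdNormalCDF_atTop.comp ha).sub (tendsto_stdNormalCDF_atBot.comp hb)
  obtain ⟨b, hb⟩ := (hlim.eventually (lt_mem_nhds h1)).exists
  obtain ⟨c, hc⟩ := mem_range_of_exists_le_of_exists_ge hcont
    ⟨0, by simpa [coverageProb] using h0.le⟩ ⟨b, hb.le⟩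
  exact ⟨c, hc.symm, fun d hd => (strictMono_coverageProb ht).injective (hd.symm.trans hc.symm)⟩

lemma coverageProb_zero_left (z : ℝ) : coverageProb 0 z = 2 * stdNormalCDF z - 1 := by
  simp [coverageProb, stdNormalCDF_neg]; ring

/-! ### The coverage probability as a function of the angle -/

/-- Only the last factor depends on the sign of `z`, so the contributions of the two endpoints
combine into `cosh` and `sinh`. -/
lemma stdNormalPDF_coverageProb_upper {t : ℝ} (z : ℝ) (ht : Real.cos t ≠ 0) :
    stdNormalPDF (z * (Real.cos t)⁻¹ - Real.tan t) = stdNormalPDF z *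
      Real.exp (-(Real.sin t ^ 2 * (1 + z ^ 2)) / (2 * Real.cos t ^ 2)) *
      Real.exp (z * Real.sin t / Real.cos t ^ 2) := by
  rw [stdNormalPDF, stdNormalPDF, mul_assoc, mul_assoc, ← Real.exp_add, ← Real.exp_add]
  congr 2
  rw [Real.tan_eq_sin_div_cos]
  field_simp
  rw [Real.cos_sq']
  ring

/-- The derivative of the coverage probability in the angle, in factored form. -/
lemma hasDerivAt_coverageProb {t : ℝ} (z : ℝ) (ht : Real.cos t ≠ 0) :
    HasDerivAt (fun t => coverageProb t z)
      (2 * stdNormalPDF z *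
        Real.exp (-(Real.sin t ^ 2 * (1 + z ^ 2)) / (2 * Real.cos t ^ 2)) / Real.cos t ^ 2 *
        (z * Real.sin t * Real.cosh (z * Real.sin t / Real.cos t ^ 2) -
          Real.sinh (z * Real.sin t / Real.cos t ^ 2))) t := by
  have hd : ∀ z : ℝ, HasDerivAt (fun t => stdNormalCDF (z * (Real.cos t)⁻¹ - Real.tan t))
      (stdNormalPDF (z * (Real.cos t)⁻¹ - Real.tan t) *
        ((z * Real.sin t - 1) / Real.cos t ^ 2)) t := by
    intro z
    have h1 : HasDerivAt (fun t => z * (Real.cos t)⁻¹ - Real.tan t)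
        ((z * Real.sin t - 1) / Real.cos t ^ 2) t := by
      refine ((((Real.hasDerivAt_cos t).fun_inv ht).const_mul z).sub
        (Real.hasDerivAt_tan ht)).congr_deriv ?_
      field_simp
    exact (hasDerivAt_stdNormalCDF _).comp t h1
  refine ((hd z).sub (hd (-z))).congr_deriv ?_
  rw [stdNormalPDF_coverageProb_upper z ht, stdNormalPDF_coverageProb_upper (-z) ht,
    Real.cosh_eq, Real.sinh_eq]
  have : stdNormalPDF (-z) = stdNormalPDF z := by simp [stdNormalPDF]
  rw [this, neg_sq, neg_mul, neg_div (Real.cos t ^ 2)]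
  field_simp
  ring

/-- The addition formula, with `u` written as a hyperbolic tangent. It gives both the sign and, for
small `v - artanh u`, the size of the derivative. -/
lemma sinh_sub_mul_cosh {u v : ℝ} (h0 : 0 ≤ u) (h1 : u < 1) :
    Real.sinh v - u * Real.cosh v = √(1 - u ^ 2) * Real.sinh (v - Real.artanh u) := by
  have hu : u ∈ Ioo (-1 : ℝ) 1 := ⟨by linarith, h1⟩
  have : 0 < √(1 - u ^ 2) := Real.sqrt_pos.2 (by nlinarith)
  rw [Real.sinh_sub, Real.sinh_artanh hu, Real.cosh_artanh hu]
  field_simp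

lemma sum_range_le_artanh {u : ℝ} (h0 : 0 ≤ u) (h1 : u < 1) (n : ℕ) :
    u * ∑ k ∈ Finset.range n, (u ^ 2) ^ k / (2 * k + 1) ≤ Real.artanh u := by
  rw [Real.artanh_eq_half_log ⟨by linarith, h1.le⟩, Finset.mul_sum]
  refine le_trans (le_of_eq ?_) (Real.sum_range_le_log_div h0 h1 n)
  refine Finset.sum_congr rfl fun k _ => ?_
  rw [← pow_mul]
  ring

/-- `sinh v < u cosh v` whenever `u ≥ 1` or `v < artanh u`. -/
lemma sinh_lt_mul_cosh {u v : ℝ} (h0 : 0 ≤ u) (h : u < 1 → v < Real.artanh u) :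
    Real.sinh v < u * Real.cosh v := by
  rcases lt_or_ge u 1 with h1 | h1
  · have h2 := sinh_sub_mul_cosh (v := v) h0 h1
    have h3 : Real.sinh (v - Real.artanh u) < 0 := Real.sinh_neg_iff.2 (by linarith [h h1])
    have : 0 < √(1 - u ^ 2) := Real.sqrt_pos.2 (by nlinarith)
    nlinarith
  · have := Real.sinh_lt_cosh v
    nlinarith [Real.cosh_pos v]

/-- The coverage probability increases in the angle where a partial sum of the power series of
`artanh u / u` exceeds `1 / cos t ^ 2`. -/
lemma strictMonoOn_coverageProb {z a : ℝ} (hz : 0 < z) (ha : 0 ≤ a) (n : ℕ)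
    (h : ∀ t, a < t → t < Real.pi / 2 → z * Real.sin t < 1 →
      1 < (1 - Real.sin t ^ 2) *
        ∑ k ∈ Finset.range n, ((z * Real.sin t) ^ 2) ^ k / (2 * k + 1)) :
    StrictMonoOn (fun t => coverageProb t z) (Ico a (Real.pi / 2)) := by
  have hpi := Real.pi_pos
  have hcos : ∀ t ∈ Ico a (Real.pi / 2), 0 < Real.cos t := fun t ht =>
    Real.cos_pos_of_mem_Ioo ⟨by linarith [ht.1], ht.2⟩
  refine strictMonoOn_of_hasDerivWithinAt_pos (convex_Ico _ _)
    (fun t ht => (hasDerivAt_coverageProb z (hcos t ht).ne').continuousAt.continuousWithinAt)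
    (fun t ht => (hasDerivAt_coverageProb z
      (hcos t (interior_subset ht)).ne').hasDerivWithinAt) fun t ht => ?_
  have hc := hcos t (interior_subset ht)
  rw [interior_Ico] at ht
  have hs : 0 < Real.sin t := Real.sin_pos_of_pos_of_lt_pi (by linarith [ht.1]) (by linarith [ht.2])
  have hpdf := stdNormalPDF_pos z
  refine mul_pos (by positivity) (sub_pos.2 (sinh_lt_mul_cosh (by positivity) fun hu => ?_))
  refine lt_of_lt_of_le ?_ (sum_range_le_artanh (by positivity) hu n)
  have h1 := h t ht.1 ht.2 hu
  rw [← Real.cos_sq'] at h1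
  rw [div_lt_iff₀ (by positivity)]
  have : 0 < z * Real.sin t := by positivity
  nlinarith

/-- With `U = (z sin t) ^ 2`, the hypothesis gives `sin t ^ 2 ≤ U / 3`, and three terms suffice: `(1
- U/3)(1 + U/3 + U²/5) = 1 + U² (4 - 3 U) / 45`. -/
lemma strictMonoOn_coverageProb_of_three_le_sq {z : ℝ} (hz : 0 < z) (hz3 : 3 ≤ z ^ 2) :
    StrictMonoOn (fun t => coverageProb t z) (Ico 0 (Real.pi / 2)) := by
  refine strictMonoOn_coverageProb hz le_rfl 3 fun t h0 h1 hu => ?_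
  have hs : 0 < Real.sin t := Real.sin_pos_of_pos_of_lt_pi h0 (by linarith [Real.pi_pos])
  have hU1 : (z * Real.sin t) ^ 2 < 1 := by
    have : 0 < z * Real.sin t := by positivity
    nlinarith
  have hU0 : 0 < (z * Real.sin t) ^ 2 := by positivity
  have hy : Real.sin t ^ 2 ≤ (z * Real.sin t) ^ 2 / 3 := by
    rw [mul_pow]; nlinarith [sq_nonneg (Real.sin t)]
  generalize (z * Real.sin t) ^ 2 = U at *
  have h2 : (1 - U / 3) * (1 + U / 3 + U ^ 2 / 5) ≤
      (1 - Real.sin t ^ 2) * (1 + U / 3 + U ^ 2 / 5) := by gcongr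
  have h3 : 0 < U ^ 2 * (1 - U) := mul_pos (by positivity) (by linarith)
  have h4 : 0 < U ^ 2 := by positivity
  norm_num [Finset.sum_range_succ]
  nlinarith

lemma sinh_le_mul_of_le {x : ℝ} (h0 : 0 ≤ x) (h1 : x ≤ 0.01) : Real.sinh x ≤ 1.0001 * x := by
  have hx : |x| ≤ 1 := by rw [abs_of_nonneg h0]; linarith
  have ha := Real.exp_bound hx (n := 3) (by norm_num)
  have hb := Real.exp_bound (x := -x) (by rwa [abs_neg]) (n := 3) (by norm_num)
  rw [abs_neg] at hb
  rw [abs_of_nonneg h0, abs_le] at ha hb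
  norm_num [Finset.sum_range_succ, Nat.factorial] at ha hb
  have h3 : x ^ 3 ≤ 0.0001 * x := by nlinarith [mul_nonneg h0 h0]
  rw [Real.sinh_eq]
  linarith [ha.2, hb.1]

lemma one_sub_le_exp_neg {x : ℝ} (h0 : 0 ≤ x) (h1 : x < 1) :
    1 - x ≤ Real.exp (-x - x ^ 2 / 2) := by
  have h := (Real.hasSum_pow_div_log_of_abs_lt_one (abs_lt.2 ⟨by linarith, h1⟩)).summable.sum_le_tsum
    (Finset.range 2) fun k _ => by positivity
  rw [(Real.hasSum_pow_div_log_of_abs_lt_one (abs_lt.2 ⟨by linarith, h1⟩)).tsum_eq] at h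
  norm_num [Finset.sum_range_succ] at h
  rw [← Real.log_le_iff_le_exp (by linarith)]
  linarith

/-- This is `log w ≤ sinh (log w)` at `w = x⁻¹`. -/
lemma inv_le_exp_half_sub {x : ℝ} (h0 : 0 < x) (h1 : x ≤ 1) :
    x⁻¹ ≤ Real.exp ((x⁻¹ - x) / 2) := by
  have h := Real.self_le_sinh_iff.2 (Real.log_nonneg ((one_le_inv₀ h0).2 h1))
  rw [Real.sinh_log (inv_pos.2 h0), inv_inv] at h
  rwa [← Real.log_le_iff_le_exp (inv_pos.2 h0)]

/-! ### The minimal coverage probability at the level 90% -/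

/-- An upper bound of the weight `(1 - u ^ 2) ^ (1 / 2) / cos t ^ 3 * exp (…)` in the derivative
of the coverage probability, with `y = sin t ^ 2` and `c = cos t`. -/
lemma sqrt_mul_exp_le {y c : ℝ} (h0 : 0 ≤ y) (h1 : y ≤ 0.1232) (hc : 0 < c) (hcy : c ^ 2 = 1 - y) :
    √(1 - 1.645083 ^ 2 * y) * Real.exp (-(y * (1 + 1.645083 ^ 2)) / (2 * c ^ 2)) ≤
      c ^ 3 * (1 - 1.7 * y - 0.8 * y ^ 2) := by
  set W : ℝ := 1.645083 ^ 2 with hW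
  have hWu : W ≤ 2.7063 := by rw [hW]; norm_num
  have hWl : 2.7062 ≤ W := by rw [hW]; norm_num
  have hy : 0 < 1 - y := by linarith
  have hWy : W * y < 1 := by
    calc W * y ≤ 2.7063 * 0.1232 := by gcongr
      _ < 1 := by norm_num
  have hWy0 : 0 ≤ W * y := by positivity
  have hM : 0 ≤ 1 - 1.7 * y - 0.8 * y ^ 2 := by nlinarith
  have hsqrt := one_sub_le_exp_neg hWy0 hWy
  have hinv := inv_le_exp_half_sub hy (by linarith)
  have ha := neg_one_pow_mul_exp_neg_sub_sum_nonneg 3 (x := 1.7 * y + 2.93 * y ^ 2) (by positivity)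
  norm_num [Finset.sum_range_succ, Nat.factorial] at ha
  have hexp : Real.exp (-(1.7 * y + 2.93 * y ^ 2)) ≤ 1 - 1.7 * y - 0.8 * y ^ 2 := by
    have h3 : y ^ 2 * (0.679 - 4.981 * y - 4.29245 * y ^ 2) ≥ 0 := by
      apply mul_nonneg (by positivity); nlinarith
    norm_num at ha h3 ⊢
    nlinarith
  -- To first order the left side is `-2 (W - 1) y`, and `1.7` is just below `W - 1`.
  have hexponent : (-(W * y) - (W * y) ^ 2 / 2) + 3 * (((1 - y)⁻¹ - (1 - y)) / 2) +
      2 * (-(y * (1 + W)) / (2 * c ^ 2)) ≤ 2 * (-(1.7 * y + 2.93 * y ^ 2)) := by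
    rw [hcy, ← sub_nonneg]
    have : 2 * (-(1.7 * y + 2.93 * y ^ 2)) - ((-(W * y) - (W * y) ^ 2 / 2) +
      3 * (((1 - y)⁻¹ - (1 - y)) / 2) + 2 * (-(y * (1 + W)) / (2 * (1 - y)))) =
        y * ((W * (2 - y) + W ^ 2 * y * (1 - y) / 2 - 2 + 1.5 * y - 3.4 * (1 - y)
          - 5.86 * y * (1 - y))) / (1 - y) := by
      field_simp
      ring
    rw [this]
    refine div_nonneg (mul_nonneg h0 ?_) hy.le
    have hW2 : 2.7062 ^ 2 ≤ W ^ 2 := by gcongr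
    have h4 : 2.7062 ^ 2 * (y * (1 - y)) ≤ W ^ 2 * (y * (1 - y)) := by gcongr
    have h5 : 2.7062 * (2 - y) ≤ W * (2 - y) := by
      apply mul_le_mul_of_nonneg_right hWl; linarith
    nlinarith
  have hc6 : c ^ 6 = (1 - y) ^ 3 := by rw [← hcy]; ring
  -- Squaring removes the root, so that every factor can be bounded by an exponential.
  refine abs_le_of_sq_le_sq' ?_ (by positivity) |>.2
  calc (√(1 - W * y) * Real.exp (-(y * (1 + W)) / (2 * c ^ 2))) ^ 2
      = (1 - W * y) * Real.exp (2 * (-(y * (1 + W)) / (2 * c ^ 2))) := by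
        rw [mul_pow, Real.sq_sqrt (by linarith), ← Real.exp_nat_mul]; norm_num
    _ = c ^ 6 * ((1 - W * y) * (1 - y)⁻¹ ^ 3 *
          Real.exp (2 * (-(y * (1 + W)) / (2 * c ^ 2)))) := by
        rw [hc6]; field_simp
    _ ≤ c ^ 6 * (Real.exp (-(W * y) - (W * y) ^ 2 / 2) *
          Real.exp (((1 - y)⁻¹ - (1 - y)) / 2) ^ 3 *
          Real.exp (2 * (-(y * (1 + W)) / (2 * c ^ 2)))) := by gcongr
    _ = c ^ 6 * Real.exp ((-(W * y) - (W * y) ^ 2 / 2) + 3 * (((1 - y)⁻¹ - (1 - y)) / 2) +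
          2 * (-(y * (1 + W)) / (2 * c ^ 2))) := by
        rw [← Real.exp_nat_mul, ← Real.exp_add, ← Real.exp_add]; norm_num
    _ ≤ c ^ 6 * Real.exp (2 * (-(1.7 * y + 2.93 * y ^ 2))) := by gcongr
    _ = c ^ 6 * Real.exp (-(1.7 * y + 2.93 * y ^ 2)) ^ 2 := by
        rw [← Real.exp_nat_mul]; norm_num
    _ ≤ c ^ 6 * (1 - 1.7 * y - 0.8 * y ^ 2) ^ 2 := by gcongr
    _ = (c ^ 3 * (1 - 1.7 * y - 0.8 * y ^ 2)) ^ 2 := by ring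

/-- A polynomial upper bound of `y / (1 - y) - ∑ k ∈ {1, …, 6}, (W y) ^ k / (2 k + 1)` for
`W = 1.645083 ^ 2` and small `y`. -/
def driftBound (y : ℝ) : ℝ :=
  0.09794 * y - 0.4647 * y ^ 2 - 1.83127 * y ^ 3 - 4.95932 * y ^ 4 - 12.19492 * y ^ 5
    - 29.06453 * y ^ 6

/-- A primitive of `driftBound y * (1 - 1.7 y - 0.8 y ^ 2) + 0.00001`. -/
def coverageLossBound (y : ℝ) : ℝ :=
  0.00001 * y + 0.09794 * y ^ 2 / 2 - 0.631198 * y ^ 3 / 3 - 1.119632 * y ^ 4 / 4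
    - 1.474401 * y ^ 5 / 5 - 2.29906 * y ^ 6 / 6 - 4.36571 * y ^ 7 / 7
    + 59.165637 * y ^ 8 / 8 + 23.251624 * y ^ 9 / 9

lemma hasDerivAt_coverageLossBound (y : ℝ) : HasDerivAt coverageLossBound
    (driftBound y * (1 - 1.7 * y - 0.8 * y ^ 2) + 0.00001) y := by
  have h (a : ℝ) (n : ℕ) : HasDerivAt (fun y : ℝ => a * y ^ n / n) (a * (n * y ^ (n - 1)) / n) y :=
    (((hasDerivAt_pow n y)).const_mul a).div_const _
  refine (((((((((hasDerivAt_id y).const_mul 0.00001).add (h 0.09794 2)).sub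
    (h 0.631198 3)).sub (h 1.119632 4)).sub (h 1.474401 5)).sub (h 2.29906 6)).sub
    (h 4.36571 7)).add (h 59.165637 8)).add (h 23.251624 9) |>.congr_deriv ?_
  unfold driftBound
  norm_num
  ring

lemma one_div_one_sub_sub_sum_le {y W : ℝ} (h0 : 0 ≤ y) (h1 : y ≤ 0.1232) (hW : 2.7062 ≤ W) :
    1 / (1 - y) - ∑ k ∈ Finset.range 7, (W * y) ^ k / (2 * k + 1) ≤ driftBound y := by
  have hgeom : 1 / (1 - y) ≤ 1 + y + y ^ 2 + y ^ 3 + y ^ 4 + y ^ 5 + 1.15 * y ^ 6 := by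
    rw [div_le_iff₀ (by linarith)]
    have : 0 ≤ y ^ 6 * (0.15 - 1.15 * y) := mul_nonneg (by positivity) (by linarith)
    nlinarith
  have hsum : ∑ k ∈ Finset.range 7, (2.7062 * y) ^ k / (2 * k + 1) ≤
      ∑ k ∈ Finset.range 7, (W * y) ^ k / (2 * k + 1) := by gcongr
  refine le_trans (sub_le_sub hgeom hsum) ?_
  have h2 : 0 ≤ y ^ 2 := by positivity
  have h3 : 0 ≤ y ^ 3 := by positivity
  have h4 : 0 ≤ y ^ 4 := by positivity
  have h5 : 0 ≤ y ^ 5 := by positivity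
  have h6 : 0 ≤ y ^ 6 := by positivity
  unfold driftBound
  norm_num [Finset.sum_range_succ, mul_pow]
  linarith

/-- `driftBound` changes sign just before `0.1232`, hence the tiny negative lower bound; the slack
`0.00001` in `coverageLossBound` compensates for it. -/
lemma driftBound_bounds {y : ℝ} (h0 : 0 ≤ y) (h1 : y ≤ 0.1232) :
    -0.00001 ≤ driftBound y ∧ driftBound y ≤ 0.01 := by
  have h2 : y ^ 2 ≤ 0.1232 ^ 2 := by gcongr
  have h3 : y ^ 3 ≤ 0.1232 ^ 3 := by gcongr
  have h4 : y ^ 4 ≤ 0.1232 ^ 4 := by gcongr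
  have h5 : y ^ 5 ≤ 0.1232 ^ 5 := by gcongr
  have hfac : driftBound y = y * (0.09794 - 0.4647 * y - 1.83127 * y ^ 2 - 4.95932 * y ^ 3
      - 12.19492 * y ^ 4 - 29.06453 * y ^ 5) := by unfold driftBound; ring
  constructor
  · have : -0.00005 ≤ 0.09794 - 0.4647 * y - 1.83127 * y ^ 2 - 4.95932 * y ^ 3
      - 12.19492 * y ^ 4 - 29.06453 * y ^ 5 := by norm_num at *; linarith
    rw [hfac]; nlinarith
  · unfold driftBound
    have h2 : 0 ≤ 0.4647 * y ^ 2 - 0.09794 * y + 0.01 := by nlinarith [sq_nonneg (y - 0.1054)]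
    have h3 : 0 ≤ y ^ 3 := by positivity
    have h4 : 0 ≤ y ^ 4 := by positivity
    have h5 : 0 ≤ y ^ 5 := by positivity
    have h6 : 0 ≤ y ^ 6 := by positivity
    linarith

/-- The derivative of the coverage probability is bounded below by that of the primitive
`coverageLossBound`, up to common factors. -/
lemma exp_mul_sinh_sub_le {s c : ℝ} (hs : 0 ≤ s) (hc : 0 < c) (hsc : c ^ 2 = 1 - s ^ 2)
    (hs1 : s ^ 2 ≤ 0.1232) :
    Real.exp (-(s ^ 2 * (1 + 1.645083 ^ 2)) / (2 * c ^ 2)) *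
      (Real.sinh (1.645083 * s / c ^ 2) - 1.645083 * s * Real.cosh (1.645083 * s / c ^ 2)) ≤
    1.645083 * s * c ^ 3 *
      (driftBound (s ^ 2) * (1 - 1.7 * s ^ 2 - 0.8 * (s ^ 2) ^ 2) + 0.00001) := by
  have hweight := sqrt_mul_exp_le (sq_nonneg s) hs1 hc hsc
  have hdrift := one_div_one_sub_sub_sum_le (sq_nonneg s) hs1
    (show (2.7062 : ℝ) ≤ 1.645083 ^ 2 by norm_num)
  obtain ⟨hP0, hP1⟩ := driftBound_bounds (sq_nonneg s) hs1
  set u := 1.645083 * s with hu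
  have hu0 : 0 ≤ u := by positivity
  have hu1 : u < 1 := by
    have : s < 0.4 := by nlinarith
    rw [hu]; norm_num at this ⊢; linarith
  have hM0 : 0 ≤ 1 - 1.7 * s ^ 2 - 0.8 * (s ^ 2) ^ 2 := by nlinarith [sq_nonneg s]
  have hM1 : 1 - 1.7 * s ^ 2 - 0.8 * (s ^ 2) ^ 2 ≤ 1 := by nlinarith [sq_nonneg s]
  rw [sinh_sub_mul_cosh hu0 hu1]
  have hsum := sum_range_le_artanh hu0 hu1 7
  have hd : u / c ^ 2 - Real.artanh u ≤ u * driftBound (s ^ 2) := by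
    have : u / c ^ 2 = u * (1 / (1 - s ^ 2)) := by rw [hsc]; ring
    rw [hu, mul_pow, ← hu] at hsum
    rw [this]
    nlinarith
  rw [← mul_pow, ← hu] at hweight
  generalize driftBound (s ^ 2) = p at *
  generalize 1 - 1.7 * s ^ 2 - 0.8 * (s ^ 2) ^ 2 = M at *
  set E := Real.exp (-(s ^ 2 * (1 + 1.645083 ^ 2)) / (2 * c ^ 2))
  have hE : 0 < E := Real.exp_pos _
  have hpM : 0 ≤ p * M + 0.00001 := by nlinarith
  -- For `p ≤ 0` the left side is nonpositive. For `p ≥ 0` the factor `1.0001` costs at most `0.0001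
  -- * 0.01`, which the slack `0.00001` absorbs.
  rcases le_total p 0 with hp | hp
  · have h1 : Real.sinh (u / c ^ 2 - Real.artanh u) ≤ 0 :=
      Real.sinh_nonpos_iff.2 (hd.trans (mul_nonpos_of_nonneg_of_nonpos hu0 hp))
    have h2 : E * (√(1 - u ^ 2) * Real.sinh (u / c ^ 2 - Real.artanh u)) ≤ 0 :=
      mul_nonpos_of_nonneg_of_nonpos hE.le
        (mul_nonpos_of_nonneg_of_nonpos (Real.sqrt_nonneg _) h1)
    exact h2.trans (by positivity)
  · have h1 : Real.sinh (u / c ^ 2 - Real.artanh u) ≤ 1.0001 * (u * p) :=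
      (Real.sinh_le_sinh.2 hd).trans (sinh_le_mul_of_le (by positivity) (by nlinarith))
    calc E * (√(1 - u ^ 2) * Real.sinh (u / c ^ 2 - Real.artanh u))
        ≤ E * (√(1 - u ^ 2) * (1.0001 * (u * p))) := by gcongr
      _ = √(1 - u ^ 2) * E * (1.0001 * (u * p)) := by ring
      _ ≤ c ^ 3 * M * (1.0001 * (u * p)) := by gcongr
      _ = u * c ^ 3 * (1.0001 * (p * M)) := by ring
      _ ≤ u * c ^ 3 * (p * M + 0.00001) := by
        gcongr
        nlinarith

/-- The bound is increasing, so its value at the endpoint `0.1232` decides; `0.1031` bounds the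
density at `1.645083`. -/
lemma coverageLossBound_le {y : ℝ} (h0 : 0 ≤ y) (h1 : y ≤ 0.1232) :
    0.1031 * 1.645083 * coverageLossBound y ≤ 0.0000473 := by
  have hm := monotoneOn_of_hasDerivWithinAt_nonneg (convex_Icc (0 : ℝ) 0.1232)
    (fun y _ => (hasDerivAt_coverageLossBound y).continuousAt.continuousWithinAt)
    (fun y _ => (hasDerivAt_coverageLossBound y).hasDerivWithinAt)
    (fun y hy => by
      have hy' := interior_subset hy
      obtain ⟨hP0, hP1⟩ := driftBound_bounds hy'.1 hy'.2
      have h0 := hy'.1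
      have h1 := hy'.2
      have hM0 : 0 ≤ 1 - 1.7 * y - 0.8 * y ^ 2 := by nlinarith
      have hM1 : 1 - 1.7 * y - 0.8 * y ^ 2 ≤ 1 := by nlinarith
      generalize 1 - 1.7 * y - 0.8 * y ^ 2 = M at *
      nlinarith)
  have h2 := hm ⟨h0, h1⟩ ⟨by norm_num, le_rfl⟩ h1
  have h3 : 0.1031 * 1.645083 * coverageLossBound 0.1232 ≤ 0.0000473 := by
    unfold coverageLossBound; norm_num
  linarith

lemma one_lt_one_sub_mul_sum {y W : ℝ} (h0 : 0.1232 < y) (hW : 2.7062 ≤ W) (hy : W * y < 1) :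
    1 < (1 - y) * ∑ k ∈ Finset.range 7, (W * y) ^ k / (2 * k + 1) := by
  have hy1 : y < 0.37 := by nlinarith
  have hy0 : 0 < y := by linarith
  have hsum : ∑ k ∈ Finset.range 7, (2.7062 * y) ^ k / (2 * k + 1) ≤
      ∑ k ∈ Finset.range 7, (W * y) ^ k / (2 * k + 1) := by gcongr
  refine lt_of_lt_of_le ?_ (mul_le_mul_of_nonneg_left hsum (by linarith))
  have h2 : 0.1232 ^ 2 ≤ y ^ 2 := by gcongr
  have h3 : 0.1232 ^ 3 ≤ y ^ 3 := by gcongr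
  have h4 : 0.1232 ^ 4 ≤ y ^ 4 := by gcongr
  -- Truncating the series leaves a negative top coefficient; paired with the term below it, the sum
  -- still increases on `[0, 0.4]`.
  have h5 : 0.1232 ^ 5 * (17 - 30.22 * 0.1232) ≤ y ^ 5 * (17 - 30.22 * y) := by
    have hm := monotoneOn_of_hasDerivWithinAt_nonneg (convex_Icc (0 : ℝ) 0.4)
      (f := fun y => 17 * y ^ 5 - 30.22 * y ^ 6)
      (f' := fun y => 17 * (5 * y ^ 4) - 30.22 * (6 * y ^ 5))
      (by fun_prop)
      (fun y _ => (((hasDerivAt_pow 5 y).const_mul 17).sub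
        ((hasDerivAt_pow 6 y).const_mul 30.22)).hasDerivWithinAt)
      (fun y hy => by
        have hy' := interior_subset hy
        have : 0 ≤ y ^ 4 * (85 - 181.32 * y) := mul_nonneg (by positivity) (by linarith [hy'.2])
        linarith)
    have := hm ⟨by norm_num, by norm_num⟩ ⟨hy0.le, by linarith⟩ h0.le
    simp only at this
    linarith
  have key : 0 < y * (-0.097934 + 0.5626 * y + 1.3665 * y ^ 2 + 3.1276 * y ^ 3
      + 7.235 * y ^ 4 + y ^ 5 * (17 - 30.22 * y)) := by
    refine mul_pos hy0 ?_
    norm_num at *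
    linarith
  have p2 : 0 < y ^ 2 := by positivity
  have p3 : 0 < y ^ 3 := by positivity
  have p4 : 0 < y ^ 4 := by positivity
  have p5 : 0 < y ^ 5 := by positivity
  have p6 : 0 < y ^ 6 := by positivity
  have p7 : 0 < y ^ 7 := by positivity
  norm_num [Finset.sum_range_succ, mul_pow]
  nlinarith

/-- Coverage plus the accumulated loss bound is nondecreasing in the angle. The factor `c ^ 3` in
`exp_mul_sinh_sub_le` is what matches `dy = 2 sin t cos t dt` after division by `cos t ^ 2`. -/
lemma le_coverageProb_of_sin_sq_le {t : ℝ} (h0 : 0 ≤ t) (h1 : t < Real.pi / 2)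
    (ht : Real.sin t ^ 2 ≤ 0.1232) : 0.9 ≤ coverageProb t 1.645083 := by
  have hpi := Real.pi_pos
  have hcos : ∀ x ∈ Icc 0 t, 0 < Real.cos x := fun x hx =>
    Real.cos_pos_of_mem_Ioo ⟨by linarith [hx.1], by linarith [hx.2]⟩
  have hd : ∀ x ∈ Icc 0 t, HasDerivAt (fun x => coverageProb x 1.645083 +
      stdNormalPDF 1.645083 * 1.645083 * coverageLossBound (Real.sin x ^ 2)) _ x := fun x hx =>
    (hasDerivAt_coverageProb 1.645083 (hcos x hx).ne').add
      (((hasDerivAt_coverageLossBound (Real.sin x ^ 2)).comp x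
        ((Real.hasDerivAt_sin x).pow 2)).const_mul _)
  have hm := monotoneOn_of_hasDerivWithinAt_nonneg (convex_Icc 0 t)
    (fun x hx => (hd x hx).continuousAt.continuousWithinAt)
    (fun x hx => (hd x (interior_subset hx)).hasDerivWithinAt) fun x hx => by
      have hx' := interior_subset hx
      have hc := hcos x hx'
      have hs : 0 ≤ Real.sin x :=
        Real.sin_nonneg_of_nonneg_of_le_pi hx'.1 (by linarith [hx'.2])
      have hst : Real.sin x ^ 2 ≤ 0.1232 := by
        refine le_trans ?_ ht
        gcongr
        exact Real.sin_le_sin_of_le_of_le_pi_div_two (by linarith [hx'.1]) h1.le hx'.2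
      have h := exp_mul_sinh_sub_le hs hc (Real.cos_sq' x) hst
      have hpdf := stdNormalPDF_pos 1.645083
      have h2 : 0 ≤ 2 * stdNormalPDF 1.645083 / Real.cos x ^ 2 := by positivity
      have h3 := mul_le_mul_of_nonneg_left h h2
      rw [← sub_nonneg] at h3
      refine h3.trans (le_of_eq ?_)
      field_simp
      ring
  have h2 := hm ⟨le_rfl, h0⟩ ⟨h0, le_rfl⟩ h0
  have h3 := coverageLossBound_le (sq_nonneg (Real.sin t)) ht
  have h4 := stdNormalPDF_le_level_90
  have h5 := le_stdNormalCDF_level_90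
  have h6 := stdNormalPDF_pos 1.645083
  simp only [coverageProb_zero_left, Real.sin_zero] at h2
  have h7 : coverageLossBound (0 ^ 2) = 0 := by simp [coverageLossBound]
  rw [h7] at h2
  have h8 : stdNormalPDF 1.645083 * 1.645083 * coverageLossBound (Real.sin t ^ 2) ≤
      0.0000473 := by
    rcases le_total (coverageLossBound (Real.sin t ^ 2)) 0 with hn | hn
    · exact (mul_nonpos_of_nonneg_of_nonpos (by positivity) hn).trans (by norm_num)
    · refine le_trans ?_ h3
      gcongr
  norm_num at h2 h5 h8 ⊢
  linarith

/-- The critical value `1.645083` guarantees the coverage probability 90% for every angle. -/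
lemma le_coverageProb_level_90 {t : ℝ} (h0 : 0 ≤ t) (h1 : t < Real.pi / 2) :
    0.9 ≤ coverageProb t 1.645083 := by
  have hpi := Real.pi_pos
  rcases le_total (Real.sin t ^ 2) 0.1232 with ht | ht
  · exact le_coverageProb_of_sin_sq_le h0 h1 ht
  have hr : √0.1232 < 1 := by rw [Real.sqrt_lt' one_pos]; norm_num
  have hr0 : (0 : ℝ) ≤ √0.1232 := Real.sqrt_nonneg _
  set a := Real.arcsin √0.1232
  have ha0 : 0 ≤ a := Real.arcsin_nonneg.2 hr0
  have ha1 : a < Real.pi / 2 := Real.arcsin_lt_pi_div_two.2 hr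
  have hsa : Real.sin a = √0.1232 := Real.sin_arcsin (by linarith) hr.le
  have hsa2 : Real.sin a ^ 2 = 0.1232 := by rw [hsa, Real.sq_sqrt (by norm_num)]
  have hs : 0 ≤ Real.sin t := Real.sin_nonneg_of_nonneg_of_le_pi h0 (by linarith)
  have hat : a ≤ t := by
    rw [Real.arcsin_le_iff_le_sin' ⟨by linarith, h1⟩]
    exact Real.sqrt_le_iff.2 ⟨hs, ht⟩
  refine (le_coverageProb_of_sin_sq_le ha0 ha1 hsa2.le).trans ?_
  -- Past `a` coverage increases, so the bound at `a` carries over to `t`.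
  refine (strictMonoOn_coverageProb (by norm_num) ha0 7 fun x hax hx hu => ?_).monotoneOn
    ⟨le_rfl, ha1⟩ ⟨hat, h1⟩ hat
  have hlt : Real.sin a < Real.sin x :=
    Real.sin_lt_sin_of_lt_of_le_pi_div_two (by linarith) hx.le hax
  have hsx : 0.1232 < Real.sin x ^ 2 := by
    rw [← hsa2]
    exact pow_lt_pow_left₀ hlt (hsa ▸ hr0) two_ne_zero
  have hsx0 : 0 < Real.sin x := (hsa ▸ hr0).trans_lt hlt
  have hu2 : 1.645083 ^ 2 * Real.sin x ^ 2 < 1 := by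
    rw [← mul_pow]
    exact pow_lt_one₀ (by positivity) hu two_ne_zero
  rw [mul_pow]
  exact one_lt_one_sub_mul_sum hsx (by norm_num) hu2

/-! ### Calibrated critical values -/

lemma arccos_div_bounds {s₁ s₂ : ℝ} (hs₂ : 0 < s₂) (hs : s₂ < s₁) :
    Real.cos (Real.arccos (s₂ / s₁)) = s₂ / s₁ ∧ 0 < s₂ / s₁ ∧
      0 < Real.arccos (s₂ / s₁) ∧ Real.arccos (s₂ / s₁) < Real.pi / 2 := by
  have h1 : 0 < s₂ / s₁ := div_pos hs₂ (hs₂.trans hs)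
  have h2 : s₂ / s₁ < 1 := (div_lt_one (hs₂.trans hs)).2 hs
  exact ⟨Real.cos_arccos (by linarith) h2.le, h1, Real.arccos_pos.2 h2,
    Real.arccos_lt_pi_div_two.2 h1⟩

lemma stdNormalCDF_stdNormalQuantile_one_sub_half {α : ℝ} (h0 : 0 < α) (h1 : α < 1) :
    stdNormalCDF (stdNormalQuantile (1 - α / 2)) = 1 - α / 2 :=
  stdNormalCDF_stdNormalQuantile (by linarith) (by linarith)

lemma le_stdNormalQuantile_level_90 : 1.6448528 ≤ stdNormalQuantile (1 - 1 / 10 / 2) := by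
  rw [← strictMono_stdNormalCDF.le_iff_le,
    stdNormalCDF_stdNormalQuantile_one_sub_half (by norm_num) (by norm_num)]
  refine stdNormalCDF_le_level_90.trans (by norm_num)

lemma IsCalibrated.lt_stdNormalQuantile {s₁ s₂ α c : ℝ} (hs₂ : 0 < s₂) (hs : s₂ < s₁)
    (h0 : 0 < α) (h1 : 917 / 1000 < 1 - α) (hc : IsCalibrated s₁ s₂ α c) :
    c < stdNormalQuantile (1 - α / 2) := by
  obtain ⟨hcos, hpos, ht0, ht1⟩ := arccos_div_bounds hs₂ hs
  have hq := stdNormalCDF_stdNormalQuantile_one_sub_half h0 (by linarith)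
  have hz : 1.7321 < stdNormalQuantile (1 - α / 2) := by
    rw [← strictMono_stdNormalCDF.lt_iff_lt, hq]
    refine stdNormalCDF_le_level_917.trans_lt ?_
    norm_num
    linarith
  have hmono := strictMonoOn_coverageProb_of_three_le_sq (by linarith)
    (show 3 ≤ stdNormalQuantile (1 - α / 2) ^ 2 by nlinarith) ⟨le_rfl, by linarith⟩
    ⟨ht0.le, ht1⟩ ht0
  simp only [coverageProb_zero_left, hq] at hmono
  rw [← (strictMono_coverageProb (hcos ▸ hpos)).lt_iff_lt, ← hc]
  linarith

lemma IsCalibrated.le_level_90 {s₁ s₂ c : ℝ} (hs₂ : 0 < s₂) (hs : s₂ < s₁)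
    (hc : IsCalibrated s₁ s₂ (1 / 10) c) : c ≤ 1.645083 := by
  obtain ⟨hcos, hpos, ht0, ht1⟩ := arccos_div_bounds hs₂ hs
  rw [← (strictMono_coverageProb (hcos ▸ hpos)).le_iff_le, ← hc]
  refine le_trans (le_of_eq ?_) (le_coverageProb_level_90 ht0.le ht1)
  norm_num

/-- When the standard errors have a small ratio, the calibrated critical value is close to the
worst-case relative bias `1`. -/
lemma IsCalibrated.lt_of_ratio_le {s₁ s₂ c : ℝ} (hs₂ : 0 < s₂) (hs : s₂ ≤ 1 / 1000 * s₁)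
    (hc : IsCalibrated s₁ s₂ (1 / 10) c) : c < 1.003 := by
  have hs₁ : 0 < s₁ := by linarith
  obtain ⟨hcos, hpos, ht0, ht1⟩ := arccos_div_bounds hs₂ (show s₂ < s₁ by linarith)
  have hr : s₂ / s₁ ≤ 1 / 1000 := (div_le_iff₀ hs₁).2 hs
  unfold IsCalibrated at hc
  set t := Real.arccos (s₂ / s₁)
  have hcpos : 0 < Real.cos t := hcos ▸ hpos
  have hct : Real.cos t ≤ 1 / 1000 := hcos ▸ hr
  rw [← (strictMono_coverageProb hcpos).lt_iff_lt, ← hc, coverageProb]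
  have hsin : Real.sin t ≤ 1 := Real.sin_le_one t
  have hsin0 : 0 ≤ Real.sin t :=
    Real.sin_nonneg_of_nonneg_of_le_pi ht0.le (by linarith [Real.pi_pos])
  -- The numerator `1.003 - sin t` is at least `0.003` and `cos t ≤ 0.001`. The value `1.003` is
  -- just below `0.61 * 1.6448528`.
  have ha : 3 ≤ 1.003 * (Real.cos t)⁻¹ - Real.tan t := by
    rw [Real.tan_eq_sin_div_cos, ← div_eq_mul_inv, ← sub_div, le_div_iff₀ hcpos]
    norm_num
    linarith
  have hb : -1.003 * (Real.cos t)⁻¹ - Real.tan t ≤ -3 := by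
    rw [Real.tan_eq_sin_div_cos, ← div_eq_mul_inv, ← sub_div, div_le_iff₀ hcpos]
    norm_num
    linarith
  have h1 := strictMono_stdNormalCDF.monotone ha
  have h2 := strictMono_stdNormalCDF.monotone hb
  have h3 := strictMono_stdNormalCDF (show (1.645083 : ℝ) < 3 by norm_num)
  have h4 := le_stdNormalCDF_level_90
  rw [stdNormalCDF_neg] at h2
  norm_num at h1 h2 h3 h4 ⊢
  linarith

/-- The maximum accounts for the empty interval when `c * s < 0`, so the 90% bounds need no sign of
`c`. -/
lemma intervalLength_symmInterval {x c s : ℝ} :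
    intervalLength (symmInterval x c s) = max (2 * (c * s)) 0 := by
  rw [intervalLength, symmInterval, measureReal_def, Real.volume_Icc,
    ENNReal.toReal_ofReal']
  ring_nf

end

theorem theorem3 {Ω : Type*} [MeasurableSpace Ω] (P : Measure Ω) [IsProbabilityMeasure P]
    (θ b₂ s₁ s₂ : ℝ) (hs₂ : 0 < s₂) (hs : s₂ < s₁)
    (θhat₁ θhat₂ : Ω → ℝ)
    (hlaw₁ : HasLaw θhat₁ (gaussianReal θ (s₁ ^ 2).toNNReal) P)
    (hlaw₂ : HasLaw θhat₂ (gaussianReal (θ + b₂) (s₂ ^ 2).toNNReal) P)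
    (hMSE : b₂ ^ 2 + s₂ ^ 2 ≤ s₁ ^ 2) :
    -- the critical value of `CI₅` is well defined
    (∀ α : ℝ, 0 < α → α < 1 → ∃! c : ℝ, IsCalibrated s₁ s₂ α c) ∧
    -- confidence levels above 91.7%: `CI₅` is strictly shorter than `CI₂`
    (∀ α : ℝ, 0 < α → 917 / 1000 < 1 - α → ∀ c : ℝ, IsCalibrated s₁ s₂ α c →
      c < stdNormalQuantile (1 - α / 2) ∧
      ∀ ω : Ω, intervalLength (CI₅ s₁ c (θhat₂ ω)) < intervalLength (CI₂ s₁ α (θhat₂ ω))) ∧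
    -- confidence level 90%: `CI₅` is at most 0.014% longer than `CI₂`
    (∀ c : ℝ, IsCalibrated s₁ s₂ (1 / 10) c → ∀ ω : Ω,
      intervalLength (CI₅ s₁ c (θhat₂ ω)) ≤
        (1 + 14 / 100000) * intervalLength (CI₂ s₁ (1 / 10) (θhat₂ ω))) ∧
    -- confidence level 90%: `CI₅` can be significantly shorter than `CI₂`, with less than 61%
    -- of its length whenever the ratio of the standard errors is small enough
    (∃ δ : ℝ, 0 < δ ∧ δ < 1 ∧ ∀ r₁ r₂ : ℝ, 0 < r₂ → r₂ ≤ δ * r₁ →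
      ∀ c : ℝ, IsCalibrated r₁ r₂ (1 / 10) c → ∀ x : ℝ,
        intervalLength (CI₅ r₁ c x) < 61 / 100 * intervalLength (CI₂ r₁ (1 / 10) x)) := by
  have hs₁ : 0 < s₁ := hs₂.trans hs
  have hq90 := le_stdNormalQuantile_level_90
  refine ⟨fun α h0 h1 => ?_, fun α h0 h1 c hc => ?_, fun c hc ω => ?_, 1 / 1000, by norm_num,
    by norm_num, fun r₁ r₂ hr₂ hr c hc x => ?_⟩
  · obtain ⟨hcos, hpos, -, -⟩ := arccos_div_bounds hs₂ hs
    exact existsUnique_coverageProb_eq (hcos.symm ▸ hpos : 0 < Real.cos _) (by linarith) (by linarith)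
  · have hlt := hc.lt_stdNormalQuantile hs₂ hs h0 h1
    refine ⟨hlt, fun ω => ?_⟩
    have hc0 : 0 < c := by
      obtain ⟨hcos, hpos, -, -⟩ := arccos_div_bounds hs₂ hs
      rw [← (strictMono_coverageProb (hcos ▸ hpos)).lt_iff_lt, ← hc]
      simp only [coverageProb, neg_zero, sub_self]
      linarith
    have hlt' := mul_lt_mul_of_pos_right hlt hs₁
    have hcs := mul_pos hc0 hs₁
    rw [CI₅, CI₂, intervalLength_symmInterval, intervalLength_symmInterval,
      max_eq_left (by linarith), max_eq_left (by linarith)]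
    linarith
  · have hc' := hc.le_level_90 hs₂ hs
    rw [CI₅, CI₂, intervalLength_symmInterval, intervalLength_symmInterval]
    have h1 : 0 ≤ stdNormalQuantile (1 - 1 / 10 / 2) * s₁ := mul_nonneg (by linarith) hs₁.le
    rw [max_eq_left (a := 2 * (stdNormalQuantile _ * s₁)) (by linarith)]
    refine max_le ?_ (by positivity)
    have h2 : c ≤ (1 + 14 / 100000) * stdNormalQuantile (1 - 1 / 10 / 2) := by
      norm_num at hc' hq90 ⊢
      linarith
    have h3 := mul_le_mul_of_nonneg_right h2 hs₁.le
    linarith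
  · have hr₁ : 0 < r₁ := by linarith
    have hc' := hc.lt_of_ratio_le hr₂ hr
    rw [CI₅, CI₂, intervalLength_symmInterval, intervalLength_symmInterval]
    have h1 : 0 < stdNormalQuantile (1 - 1 / 10 / 2) * r₁ := mul_pos (by linarith) hr₁
    rw [max_eq_left (a := 2 * (stdNormalQuantile _ * r₁)) (by linarith)]
    refine max_lt ?_ (by positivity)
    have h2 : c < 61 / 100 * stdNormalQuantile (1 - 1 / 10 / 2) := by
      norm_num at hc' hq90 ⊢
      linarith
    have h3 := mul_lt_mul_of_pos_right h2 hr₁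
    linarith
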